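/- Let $\Psi(r)=r^4\left(\frac{r^2}{2}+\frac1r-\frac32\right)\mathbf 1(0\le r\le 1)$ for $r\ge 0$ (with $\Psi(0)=0$), let $r_*=(\sqrt5-1)/2$, and let $\chi(r)=-r^{-1}\Psi'(r)\,\mathbf 1(r_*\le r\le 1)$, which is non-negative. For a square-integrable real- or complex-valued function $f$ on $\mathbb R^3$ define the Hardy–Littlewood-type maximal function $$M^\chi_f(z)=\sup_{r>0}\left\{r^{-3}\int_{\mathbb R^3}\chi(|u|/r)\,|f(z+u)|\,du\right\}\in[0,\infty],\qquad z\in\mathbb R^3.$$ Then, for every square-integrable $f$ on $\mathbb R^3$, the function $M^\chi_f$ is measurable and $$\left(\int_{\mathbb R^3}M^\chi_f(z)^2\,dz\right)^{1/2}\le 7.5831\left(\int_{\mathbb R^3}|f(z)|^2\,dz\right)^{1/2}.$$ -/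

import Mathlib

open MeasureTheory

open scoped ENNReal

noncomputable section

/-- The profile `Ψ(r) = r⁴ (r²/2 + 1/r - 3/2) 1(0 ≤ r ≤ 1)`. -/
def Psi (r : ℝ) : ℝ :=
  (Set.Icc (0 : ℝ) 1).indicator (fun r => r ^ 4 * (r ^ 2 / 2 + 1 / r - 3 / 2)) r

/-- The point `r_* = (√5 - 1)/2` where `Ψ` attains its maximum. -/
def rStar : ℝ := (Real.sqrt 5 - 1) / 2

/-- The kernel `χ(r) = -r⁻¹ Ψ'(r) 1(r_* ≤ r ≤ 1)`. -/
def chi (r : ℝ) : ℝ :=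
  (Set.Icc rStar 1).indicator (fun r => -(r⁻¹ * deriv Psi r)) r

/-- The Hardy–Littlewood-type maximal function
`M^χ_f(z) = sup_{r > 0} r⁻³ ∫ χ(|u|/r) |f(z + u)| du`, with values in `[0, ∞]`.
Since `χ ≥ 0`, the passage to `ℝ≥0∞` loses nothing. -/
def maximalChi {𝕜 : Type*} [RCLike 𝕜] (f : EuclideanSpace ℝ (Fin 3) → 𝕜)
    (z : EuclideanSpace ℝ (Fin 3)) : ℝ≥0∞ :=
  ⨆ (r : ℝ) (_ : 0 < r),
    ENNReal.ofReal (r ^ 3)⁻¹ * ∫⁻ u, ENNReal.ofReal (chi (‖u‖ / r)) * ‖f (z + u)‖ₑ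

end

/-! Since `chi` is at most `1/4` and vanishes beyond 1, the operator is dominated by a quarter of
the centred ball maximal function. Truncating `f` at a height proportional to `t` gives a weak-type
bound on the superlevel set (`volume_lt_maximalChi_le`), by a Vitali covering of its centres.
Integrating against `2t dt` and swapping integrals gives the squared constant `(9/4)^3/4 * (4π/3)^2
≈ 49.97`, below `7.5831^2 ≈ 57.50`. Measurability comes from lower semicontinuity. -/

lemma Psi_of_mem {r : ℝ} (hr : r ∈ Set.Icc (0 : ℝ) 1) :
    Psi r = r ^ 6 / 2 + r ^ 3 - 3 / 2 * r ^ 4 := by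
  rw [Psi, Set.indicator_of_mem hr]
  rcases eq_or_ne r 0 with rfl | h
  · norm_num
  · field_simp

lemma Psi_nonneg (r : ℝ) : 0 ≤ Psi r := by
  by_cases hr : r ∈ Set.Icc (0 : ℝ) 1
  · have h : Psi r = r ^ 3 * ((r - 1) ^ 2 * (r + 2) / 2) := by rw [Psi_of_mem hr]; ring
    have := hr.1
    rw [h]
    positivity
  · rw [Psi, Set.indicator_of_notMem hr]

lemma deriv_Psi {r : ℝ} (h0 : 0 < r) (h1 : r ≤ 1) :
    deriv Psi r = 3 * r ^ 5 + 3 * r ^ 2 - 6 * r ^ 3 := by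
  rcases h1.eq_or_lt with rfl | h1
  -- The derivative at 1 is two-sided, and `Psi` is cut off there; it is nonnegative and vanishes at
  -- 1, so 1 is a minimum.
  · have : IsLocalMin Psi 1 := Filter.Eventually.of_forall fun x => by
      rw [Psi_of_mem (r := 1) (by norm_num)]
      norm_num [Psi_nonneg x]
    rw [this.deriv_eq_zero]
    norm_num
  · have : Psi =ᶠ[nhds r] fun r => r ^ 6 / 2 + r ^ 3 - 3 / 2 * r ^ 4 := by
      filter_upwards [Icc_mem_nhds h0 h1] with x hx using Psi_of_mem hx
    rw [this.deriv_eq]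
    have : HasDerivAt (fun r : ℝ => r ^ 6 / 2 + r ^ 3 - 3 / 2 * r ^ 4)
        ((6 : ℕ) * r ^ 5 / 2 + (3 : ℕ) * r ^ 2 - 3 / 2 * ((4 : ℕ) * r ^ 3)) r :=
      (((hasDerivAt_pow 6 r).div_const 2).add (hasDerivAt_pow 3 r)).sub
        ((hasDerivAt_pow 4 r).const_mul (3 / 2))
    rw [this.deriv]
    push_cast
    ring

lemma rStar_pos : 0 < rStar := by
  have : (1 : ℝ) < √5 := by rw [Real.lt_sqrt] <;> norm_num
  rw [rStar]; linarith

lemma rStar_sq : rStar ^ 2 + rStar - 1 = 0 := by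
  have : √5 ^ 2 = (5 : ℝ) := Real.sq_sqrt (by norm_num)
  rw [rStar]; linarith

lemma chi_eq_indicator :
    chi = (Set.Icc rStar 1).indicator fun r => 3 * r * (1 - r) * (r ^ 2 + r - 1) := by
  ext r
  by_cases hr : r ∈ Set.Icc rStar 1
  · have h0 : 0 < r := rStar_pos.trans_le hr.1
    rw [chi, Set.indicator_of_mem hr, Set.indicator_of_mem hr, deriv_Psi h0 hr.2]
    field_simp
    ring
  · rw [chi, Set.indicator_of_notMem hr, Set.indicator_of_notMem hr]

/-- The polynomial vanishes at both ends of the cutoff interval. -/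
lemma continuous_chi : Continuous chi := by
  rw [chi_eq_indicator]
  refine Continuous.indicator (fun r hr => ?_) (by fun_prop)
  have hle : rStar ≤ 1 := by nlinarith [rStar_sq, rStar_pos]
  rw [frontier_Icc hle] at hr
  rcases hr with rfl | hr
  · rw [rStar_sq, mul_zero]
  · rw [Set.mem_singleton_iff.1 hr]; norm_num

lemma chi_le (r : ℝ) : chi r ≤ 1 / 4 := by
  rw [chi_eq_indicator]
  refine Set.indicator_apply_le' (fun hr => ?_) fun _ => by norm_num
  have h0 : 0 < r := rStar_pos.trans_le hr.1
  nlinarith [mul_nonneg h0.le (sq_nonneg (r - 21/25)), sq_nonneg (r ^ 2 - 7/10)]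

lemma chi_eq_zero {r : ℝ} (hr : 1 < r) : chi r = 0 := by
  rw [chi, Set.indicator_of_notMem fun h => h.2.not_gt hr]

/-! ### Measurability. -/

lemma lintegral_chi_translate (g : EuclideanSpace ℝ (Fin 3) → ℝ≥0∞)
    (z : EuclideanSpace ℝ (Fin 3)) (r : ℝ) :
    ∫⁻ u, ENNReal.ofReal (chi (‖u‖ / r)) * g (z + u) =
      ∫⁻ w, ENNReal.ofReal (chi (‖w - z‖ / r)) * g w := by
  rw [← lintegral_add_left_eq_self (fun w => ENNReal.ofReal (chi (‖w - z‖ / r)) * g w) z]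
  simp

/-- Translation moves `z` into the continuous kernel, and Fatou's lemma applies. Where `g = ∞` the
integrand is only lower semicontinuous in `z`, which suffices. -/
lemma lowerSemicontinuous_lintegral_chi {g : EuclideanSpace ℝ (Fin 3) → ℝ≥0∞}
    (hg : AEMeasurable g) (r : ℝ) :
    LowerSemicontinuous fun z => ∫⁻ u, ENNReal.ofReal (chi (‖u‖ / r)) * g (z + u) := by
  simp_rw [lintegral_chi_translate]
  intro z
  refine lowerSemicontinuousAt_iff_le_liminf.2 ?_
  refine le_trans (lintegral_mono_ae ?_) (lintegral_liminf_le' fun z => ?_)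
  · refine Filter.Eventually.of_forall fun w => ?_
    by_cases hw : g w = ∞
    · by_cases h0 : ENNReal.ofReal (chi (‖w - z‖ / r)) = 0
      · simp [h0]
      · refine Filter.le_liminf_of_le (by isBoundedDefault) ?_
        have hc : Continuous fun z => ENNReal.ofReal (chi (‖w - z‖ / r)) :=
          ENNReal.continuous_ofReal.comp (continuous_chi.comp (by fun_prop))
        filter_upwards [hc.continuousAt.eventually_ne h0] with y hy
        rw [hw, ENNReal.mul_top hy]
        exact le_top
    · have hc : Continuous fun z => ENNReal.ofReal (chi (‖w - z‖ / r)) * g w :=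
        (ENNReal.continuous_mul_const hw).comp
          (ENNReal.continuous_ofReal.comp (continuous_chi.comp (by fun_prop)))
      exact (hc.tendsto z).liminf_eq.ge
  · refine AEMeasurable.mul (Continuous.measurable ?_).aemeasurable hg
    exact ENNReal.continuous_ofReal.comp (continuous_chi.comp (by fun_prop))

lemma measurable_maximalChi {𝕜 : Type*} [RCLike 𝕜] {f : EuclideanSpace ℝ (Fin 3) → 𝕜}
    (hf : AEStronglyMeasurable f) : Measurable (maximalChi f) := by
  refine LowerSemicontinuous.measurable (lowerSemicontinuous_biSup fun r _ => ?_)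
  exact (ENNReal.continuous_const_mul ENNReal.ofReal_ne_top).comp_lowerSemicontinuous
    (lowerSemicontinuous_lintegral_chi hf.enorm r) fun a b h => mul_le_mul_right h _

/-! ### Covering and weak-type bound. -/

/-- Only the centres have to be covered, so the Vitali enlargement factor is `9 / 4 > 2`. -/
lemma volume_le_of_forall_lt_setLIntegral_closedBall
    {h : EuclideanSpace ℝ (Fin 3) → ℝ≥0∞} {s : ℝ} (hs : 0 < s)
    {S : Set (EuclideanSpace ℝ (Fin 3))}
    (hS : ∀ z ∈ S, ∃ r > 0, ENNReal.ofReal (s * r ^ 3) < ∫⁻ w in Metric.closedBall z r, h w) :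
    volume S ≤ ENNReal.ofReal ((9 / 4) ^ 3 * (Real.pi * 4 / 3) / s) * ∫⁻ w, h w := by
  have hπ := Real.pi_pos
  by_cases hh : ∫⁻ w, h w = ∞
  · rw [hh, ENNReal.mul_top (ENNReal.ofReal_pos.2 (by positivity)).ne']
    exact le_top
  choose! ρ hρ hlt using hS
  have hle : ∀ z ∈ S, ρ z ≤ 1 + (∫⁻ w, h w).toReal / s := fun z hz => by
    have h1 : ENNReal.ofReal (s * ρ z ^ 3) ≤ ∫⁻ w, h w :=
      (hlt z hz).le.trans (setLIntegral_le_lintegral _ _)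
    have h2 : s * ρ z ^ 3 ≤ (∫⁻ w, h w).toReal := (ENNReal.ofReal_le_iff_le_toReal hh).1 h1
    have h3 : ρ z ^ 3 ≤ (∫⁻ w, h w).toReal / s := by rw [le_div_iff₀ hs]; linarith
    have := hρ z hz
    -- `(ρ + 1)(ρ - 1)^2 ≥ 0` yields `ρ ≤ 1 + ρ^3`: the radii are bounded, as Vitali requires.
    nlinarith [mul_nonneg (add_pos this zero_lt_one).le (sq_nonneg (ρ z - 1))]
  obtain ⟨u, huS, hdisj, hcov⟩ := Vitali.exists_disjoint_subfamily_covering_enlargement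
    (fun z => Metric.closedBall z (ρ z)) S ρ (5 / 4) (by norm_num) (fun z hz => (hρ z hz).le) _
    hle fun z hz => Metric.nonempty_closedBall.2 (hρ z hz).le
  have hu : u.Countable := hdisj.countable_of_nonempty_interior fun z hz =>
    (Metric.nonempty_ball.2 (hρ z (huS hz))).mono Metric.ball_subset_interior_closedBall
  have hsub : S ⊆ ⋃ z ∈ u, Metric.closedBall z (9 / 4 * ρ z) := fun z hz => by
    obtain ⟨y, hy, ⟨x, hxz, hxy⟩, hr⟩ := hcov z hz
    refine Set.mem_biUnion hy (Metric.mem_closedBall.2 ?_)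
    linarith [dist_triangle_left z y x, Metric.mem_closedBall.1 hxz, Metric.mem_closedBall.1 hxy]
  calc volume S ≤ ∑' z : u, volume (Metric.closedBall (z : EuclideanSpace ℝ (Fin 3)) (9 / 4 * ρ z)) :=
        (measure_mono hsub).trans (measure_biUnion_le _ hu _)
    _ ≤ ∑' z : u, ENNReal.ofReal ((9 / 4) ^ 3 * (Real.pi * 4 / 3) / s) *
          ∫⁻ w in Metric.closedBall (z : EuclideanSpace ℝ (Fin 3)) (ρ z), h w := by
        refine ENNReal.tsum_le_tsum fun z => ?_
        have h0 := hρ z (huS z.2)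
        refine le_trans (le_of_eq ?_) (mul_le_mul_right (hlt z (huS z.2)).le _)
        rw [EuclideanSpace.volume_closedBall_fin_three, ← ENNReal.ofReal_pow (by positivity),
          ← ENNReal.ofReal_mul (by positivity), ← ENNReal.ofReal_mul (by positivity)]
        congr 1
        field_simp
    _ = ENNReal.ofReal ((9 / 4) ^ 3 * (Real.pi * 4 / 3) / s) *
          ∫⁻ w in ⋃ z ∈ u, Metric.closedBall z (ρ z), h w := by
        rw [ENNReal.tsum_mul_left,
          lintegral_biUnion hu (fun _ _ => Metric.isClosed_closedBall.measurableSet) hdisj]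
    _ ≤ _ := by gcongr; exact Measure.restrict_le_self

lemma lintegral_chi_le {g : EuclideanSpace ℝ (Fin 3) → ℝ≥0∞} {r : ℝ} (hr : 0 < r)
    (z : EuclideanSpace ℝ (Fin 3)) :
    ∫⁻ u, ENNReal.ofReal (chi (‖u‖ / r)) * g (z + u) ≤
      ENNReal.ofReal (1 / 4) * ∫⁻ w in Metric.closedBall z r, g w := by
  rw [lintegral_chi_translate, ← lintegral_indicator Metric.isClosed_closedBall.measurableSet,
    ← lintegral_const_mul' _ _ ENNReal.ofReal_ne_top]
  refine lintegral_mono fun w => ?_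
  by_cases hw : w ∈ Metric.closedBall z r
  · rw [Set.indicator_of_mem hw]
    gcongr
    exact chi_le _
  · rw [Metric.mem_closedBall, not_le, dist_eq_norm] at hw
    rw [chi_eq_zero ((one_lt_div hr).2 hw)]
    simp

/-- Some ball has `∫ |f| > 4 t r^3`; the truncation height is chosen so that it removes at most half
of this. -/
lemma exists_lt_setLIntegral_of_lt_maximalChi {𝕜 : Type*} [RCLike 𝕜]
    {f : EuclideanSpace ℝ (Fin 3) → 𝕜} {z : EuclideanSpace ℝ (Fin 3)} {t : ℝ} (ht : 0 < t)
    (hz : ENNReal.ofReal t < maximalChi f z) :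
    ∃ r > 0, ENNReal.ofReal (2 * t * r ^ 3) < ∫⁻ w in Metric.closedBall z r,
      (‖f w‖ₑ - ENNReal.ofReal (2 * t / (Real.pi * 4 / 3))) := by
  have hπ := Real.pi_pos
  simp only [maximalChi, lt_iSup_iff] at hz
  obtain ⟨r, hr, hz⟩ := hz
  refine ⟨r, hr, ?_⟩
  by_contra! hcon
  refine hz.not_ge ?_
  calc _ ≤ ENNReal.ofReal (r ^ 3)⁻¹ *
        (ENNReal.ofReal (1 / 4) * ∫⁻ w in Metric.closedBall z r, ‖f w‖ₑ) :=
        mul_le_mul_right (lintegral_chi_le (g := fun w => ‖f w‖ₑ) hr z) _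
    _ ≤ ENNReal.ofReal (r ^ 3)⁻¹ * (ENNReal.ofReal (1 / 4) * (ENNReal.ofReal (2 * t * r ^ 3) +
          ENNReal.ofReal (2 * t / (Real.pi * 4 / 3)) * volume (Metric.closedBall z r))) := by
        gcongr
        refine le_trans ?_ (add_le_add_left hcon _)
        rw [← setLIntegral_const, ← lintegral_add_right _ measurable_const]
        exact lintegral_mono fun w => le_tsub_add
    _ = ENNReal.ofReal t := by
        rw [EuclideanSpace.volume_closedBall_fin_three, ← ENNReal.ofReal_pow hr.le,
          ← ENNReal.ofReal_mul (by positivity), ← ENNReal.ofReal_mul (by positivity),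
          ← ENNReal.ofReal_add (by positivity) (by positivity),
          ← ENNReal.ofReal_mul (by positivity), ← ENNReal.ofReal_mul (by positivity)]
        congr 1
        field_simp
        norm_num

lemma volume_lt_maximalChi_le {𝕜 : Type*} [RCLike 𝕜]
    (f : EuclideanSpace ℝ (Fin 3) → 𝕜) {t : ℝ} (ht : 0 < t) :
    volume {z | ENNReal.ofReal t < maximalChi f z} ≤
      ENNReal.ofReal ((9 / 4) ^ 3 * (Real.pi * 4 / 3) / (2 * t)) *
        ∫⁻ w, (‖f w‖ₑ - ENNReal.ofReal (2 * t / (Real.pi * 4 / 3))) :=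
  volume_le_of_forall_lt_setLIntegral_closedBall (by positivity)
    fun _ hz => exists_lt_setLIntegral_of_lt_maximalChi ht hz

/-! ### Layer-cake integration. -/

lemma ENNReal.sq_le_setLIntegral_indicator (a : ℝ≥0∞) :
    a ^ 2 ≤ ∫⁻ t in Set.Ioi (0 : ℝ),
      ENNReal.ofReal (2 * t) * {t : ℝ | ENNReal.ofReal t < a}.indicator 1 t := by
  have key : ∀ b : ℝ, 0 ≤ b → ENNReal.ofReal b ≤ a → ENNReal.ofReal (b ^ 2) ≤
      ∫⁻ t in Set.Ioi (0 : ℝ),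
        ENNReal.ofReal (2 * t) * {t : ℝ | ENNReal.ofReal t < a}.indicator 1 t := by
    intro b hb hba
    have hint : ENNReal.ofReal (b ^ 2) = ∫⁻ t in Set.Ioo 0 b, ENNReal.ofReal (2 * t) := by
      rw [← ofReal_integral_eq_lintegral_ofReal]
      · rw [← integral_Ioc_eq_integral_Ioo, ← intervalIntegral.integral_of_le hb,
          intervalIntegral.integral_const_mul, integral_id]
        congr 1
        ring
      · exact (Continuous.integrableOn_Icc (by fun_prop)).mono_set Set.Ioo_subset_Icc_self
      · exact (ae_restrict_iff' measurableSet_Ioo).2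
          (Filter.Eventually.of_forall fun t ht => by simpa using ht.1.le)
    rw [hint]
    refine le_trans (le_of_eq (setLIntegral_congr_fun measurableSet_Ioo fun t ht => ?_))
      (lintegral_mono_set Set.Ioo_subset_Ioi_self)
    have : t ∈ {t : ℝ | ENNReal.ofReal t < a} :=
      ((ENNReal.ofReal_lt_ofReal_iff (ht.1.trans ht.2)).2 ht.2).trans_le hba
    simp [Set.indicator_of_mem this]
  rcases eq_or_ne a ∞ with rfl | ha
  · refine le_of_le_of_eq le_top (Eq.symm (ENNReal.eq_top_of_forall_nnreal_le fun x => ?_))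
    refine le_trans ?_ (key (√x) (Real.sqrt_nonneg _) le_top)
    rw [Real.sq_sqrt x.coe_nonneg, ENNReal.ofReal_coe_nnreal]
  · have := key a.toReal ENNReal.toReal_nonneg (ENNReal.ofReal_toReal ha).le
    rwa [ENNReal.ofReal_pow ENNReal.toReal_nonneg, ENNReal.ofReal_toReal ha] at this

lemma setLIntegral_ofReal_sub_mul_le {b k : ℝ} (hb : 0 ≤ b) (hk : 0 < k) :
    ∫⁻ t in Set.Ioi (0 : ℝ), (ENNReal.ofReal b - ENNReal.ofReal (k * t)) ≤
      ENNReal.ofReal (b ^ 2 / (2 * k)) := by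
  have hbk : 0 ≤ b / k := by positivity
  have hint : ∫⁻ t in Set.Ioc 0 (b / k), ENNReal.ofReal (b - k * t) =
      ENNReal.ofReal (b ^ 2 / (2 * k)) := by
    rw [← ofReal_integral_eq_lintegral_ofReal]
    · rw [← intervalIntegral.integral_of_le hbk, intervalIntegral.integral_sub
        (Continuous.intervalIntegrable (by fun_prop) _ _)
        (Continuous.intervalIntegrable (by fun_prop) _ _), intervalIntegral.integral_const_mul, integral_id,
        intervalIntegral.integral_const]
      congr 1
      simp only [smul_eq_mul]
      field_simp
      ring
    · exact (Continuous.integrableOn_Icc (by fun_prop)).mono_set Set.Ioc_subset_Icc_self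
    · refine (ae_restrict_iff' measurableSet_Ioc).2 (Filter.Eventually.of_forall fun t ht => ?_)
      have := (le_div_iff₀ hk).1 ht.2
      simp only [Pi.zero_apply]
      linarith
  rw [← hint, ← lintegral_indicator measurableSet_Ioc, ← lintegral_indicator measurableSet_Ioi]
  refine lintegral_mono fun t => Set.indicator_apply_le' (fun ht => ?_) fun _ => zero_le
  have ht : 0 < t := ht
  rw [← ENNReal.ofReal_sub _ (by positivity)]
  by_cases h : t ≤ b / k
  · rw [Set.indicator_of_mem (Set.mem_Ioc.2 ⟨ht, h⟩)]
  · rw [ENNReal.ofReal_of_nonpos]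
    · exact zero_le
    · have := (div_lt_iff₀ hk).1 (not_le.1 h)
      linarith

lemma lintegral_maximalChi_sq_le {𝕜 : Type*} [RCLike 𝕜]
    {f : EuclideanSpace ℝ (Fin 3) → 𝕜} (hf : AEStronglyMeasurable f) :
    ∫⁻ z, maximalChi f z ^ 2 ≤
      ENNReal.ofReal ((9 / 4) ^ 3 / 4 * (Real.pi * 4 / 3) ^ 2) * ∫⁻ z, ‖f z‖ₑ ^ 2 := by
  have hπ := Real.pi_pos
  have hM := measurable_maximalChi hf
  have hset : MeasurableSet {p : EuclideanSpace ℝ (Fin 3) × ℝ |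
      ENNReal.ofReal p.2 < maximalChi f p.1} :=
    measurableSet_lt (ENNReal.measurable_ofReal.comp measurable_snd) (hM.comp measurable_fst)
  let C := ENNReal.ofReal ((9 / 4) ^ 3 * (Real.pi * 4 / 3))
  calc ∫⁻ z, maximalChi f z ^ 2
      ≤ ∫⁻ z, ∫⁻ t in Set.Ioi (0 : ℝ), ENNReal.ofReal (2 * t) *
          {t : ℝ | ENNReal.ofReal t < maximalChi f z}.indicator 1 t :=
        lintegral_mono fun z => ENNReal.sq_le_setLIntegral_indicator _
    _ = ∫⁻ t in Set.Ioi (0 : ℝ), ∫⁻ z, ENNReal.ofReal (2 * t) *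
          {z | ENNReal.ofReal t < maximalChi f z}.indicator 1 z := by
        refine lintegral_lintegral_swap (Measurable.aemeasurable ?_)
        exact (ENNReal.measurable_ofReal.comp (measurable_snd.const_mul 2)).mul
          (measurable_one.indicator hset)
    _ = ∫⁻ t in Set.Ioi (0 : ℝ), ENNReal.ofReal (2 * t) *
          volume {z | ENNReal.ofReal t < maximalChi f z} := by
        refine lintegral_congr fun t => ?_
        rw [lintegral_const_mul' _ _ ENNReal.ofReal_ne_top,
          lintegral_indicator_one (measurableSet_lt measurable_const hM)]
    -- The weight `2t` cancels the `1/(2t)` of the weak-type bound.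
    _ ≤ ∫⁻ t in Set.Ioi (0 : ℝ), ∫⁻ w, C *
          (‖f w‖ₑ - ENNReal.ofReal (2 / (Real.pi * 4 / 3) * t)) := by
        refine setLIntegral_mono' measurableSet_Ioi fun t ht => ?_
        have ht : 0 < t := ht
        rw [lintegral_const_mul' _ _ ENNReal.ofReal_ne_top]
        refine (mul_le_mul_right (volume_lt_maximalChi_le f ht) _).trans (le_of_eq ?_)
        rw [← mul_assoc, ← ENNReal.ofReal_mul (by positivity)]
        congr 2
        · field_simp
        · ext w
          congr 2
          ring
    _ = ∫⁻ w, ∫⁻ t in Set.Ioi (0 : ℝ), C *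
          (‖f w‖ₑ - ENNReal.ofReal (2 / (Real.pi * 4 / 3) * t)) := by
        refine lintegral_lintegral_swap ?_
        refine AEMeasurable.const_mul (f := fun p : ℝ × EuclideanSpace ℝ (Fin 3) =>
          ‖f p.2‖ₑ - ENNReal.ofReal (2 / (Real.pi * 4 / 3) * p.1)) ?_ _
        refine AEMeasurable.sub (f := fun p : ℝ × EuclideanSpace ℝ (Fin 3) => ‖f p.2‖ₑ)
          (g := fun p => ENNReal.ofReal (2 / (Real.pi * 4 / 3) * p.1)) ?_ ?_
        · exact hf.enorm.comp_snd
        · exact (ENNReal.measurable_ofReal.comp (measurable_fst.const_mul _)).aemeasurable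
    _ ≤ ∫⁻ w, ENNReal.ofReal ((9 / 4) ^ 3 / 4 * (Real.pi * 4 / 3) ^ 2) * ‖f w‖ₑ ^ 2 := by
        refine lintegral_mono fun w => ?_
        rw [lintegral_const_mul' _ _ ENNReal.ofReal_ne_top, ← ofReal_norm]
        refine (mul_le_mul_right (setLIntegral_ofReal_sub_mul_le (norm_nonneg _)
          (by positivity)) _).trans (le_of_eq ?_)
        rw [← ENNReal.ofReal_pow (norm_nonneg _), ← ENNReal.ofReal_mul (by positivity),
          ← ENNReal.ofReal_mul (by positivity)]
        congr 1
        field_simp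
        ring
    _ = _ := lintegral_const_mul' _ _ ENNReal.ofReal_ne_top

theorem lemma1 {𝕜 : Type*} [RCLike 𝕜] (f : EuclideanSpace ℝ (Fin 3) → 𝕜)
    (hf : MemLp f 2 volume) :
    Measurable (maximalChi f) ∧
      (∫⁻ z, maximalChi f z ^ 2) ^ (1 / 2 : ℝ) ≤
        ENNReal.ofReal 7.5831 * (∫⁻ z, ‖f z‖ₑ ^ 2) ^ (1 / 2 : ℝ) := by
  refine ⟨measurable_maximalChi hf.1, ?_⟩
  have hconst : ENNReal.ofReal ((9 / 4) ^ 3 / 4 * (Real.pi * 4 / 3) ^ 2) ≤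
      ENNReal.ofReal 7.5831 ^ (2 : ℝ) := by
    rw [ENNReal.ofReal_rpow_of_pos (by norm_num)]
    refine ENNReal.ofReal_le_ofReal ?_
    have h1 := Real.pi_lt_d2
    have h2 := Real.pi_pos
    norm_num
    nlinarith
  calc (∫⁻ z, maximalChi f z ^ 2) ^ (1 / 2 : ℝ)
      ≤ (ENNReal.ofReal 7.5831 ^ (2 : ℝ) * ∫⁻ z, ‖f z‖ₑ ^ 2) ^ (1 / 2 : ℝ) := by
        gcongr
        exact (lintegral_maximalChi_sq_le hf.1).trans (mul_le_mul_left hconst _)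
    _ = _ := by
        rw [ENNReal.mul_rpow_of_nonneg _ _ (by norm_num), ← ENNReal.rpow_mul]
        norm_num
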